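/- Let $\Sigma$ be an oriented smooth surface (possibly with boundary) and let $K$ be a field (for instance $K=\mathbb{C}$). A link in $\Sigma\times[0,1]$ is an isotopy class of smooth embeddings of a finite (possibly empty) disjoint union of oriented circles into $\Sigma\times[0,1]$, the components not being numbered. Let $L(\Sigma)$ be the $K$-vector space with basis the set of links. A link diagram $D$ consists of an immersion of finitely many circles into $\Sigma$ whose only multiple points are transverse double points (its vertices) $v_1,\dots,v_n$, together with an oriented crossing number $\epsilon_i\in\{+1,-1\}$ at each $v_i$; it determines a link $[D]=[D^{\epsilon_1,\dots,\epsilon_n}]$. For a set of vertices $v_{i_1},\dots,v_{i_m}$ of $D$ put $$\nabla_{v_{i_1},\dots,v_{i_m}}D=\sum_{\epsilon_{i_1},\dots,\epsilon_{i_m}=\pm1}\epsilon_{i_1}\cdots\epsilon_{i_m}\,[D^{\epsilon_1,\dots,\epsilon_n}]\in L(\Sigma),$$ where the crossing numbers of the other vertices are those of $D$. Let $L_m(\Sigma)\subseteq L(\Sigma)$ be the span of all elements $\nabla_{v_{i_1},\dots,v_{i_m}}D$, for all link diagrams $D$ and all sets of $m$ vertices of $D$, and let $L_\infty(\Sigma)=\bigcap_{m\ge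 0}L_m(\Sigma)$. A $K$-valued link invariant $v$, extended linearly to $L(\Sigma)$, is of finite type if $v|_{L_n(\Sigma)}=0$ for some $n$. Then the following are equivalent: 1. for any two distinct links $L_1\ne L_2$ in $\Sigma\times[0,1]$ there is a finite type invariant $v$ with $v(L_1)\ne v(L_2)$; 2. $L_\infty(\Sigma)=0$. The same equivalence holds for framed links, where a framed link is an isotopy class of embeddings as above equipped with a smooth nowhere tangent vector field along them, and the framed link $[D]$ of a diagram $D$ carries the blackboard framing. -/

import Mathlib

open scoped Manifold ContDiff Topology

noncomputable section

namespace SurfaceLinks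

/-- The model vector space of a surface. -/
abbrev Plane : Type := EuclideanSpace ℝ (Fin 2)

variable {H : Type*} [TopologicalSpace H] (I : ModelWithCorners ℝ Plane H)
variable (S : Type*) [TopologicalSpace S] [ChartedSpace H S] [IsManifold I ∞ S]

/-- An orientation of the surface `S`: an orientation of every tangent plane, which is constant
near every point when it is read in the trivialisation of the tangent bundle at that point. -/
structure SurfaceOrientation where
  /-- the orientation of the tangent plane at `x` -/
  orient : ∀ x : S, Orientation ℝ (TangentSpace I x) (Fin 2)
  locallyConstant : ∀ x₀ : S, ∃ o₀ : Orientation ℝ Plane (Fin 2), ∀ᶠ x in 𝓝 x₀,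
    ∃ hx : x ∈ (trivializationAt Plane (TangentSpace I : S → Type _) x₀).baseSet,
      Orientation.map (Fin 2)
        ((trivializationAt Plane (TangentSpace I : S → Type _) x₀).continuousLinearEquivAt
          ℝ x hx).toLinearEquiv (orient x) = o₀

/-! ### Links in `S × [0,1]` -/

/-- The model with corners of the thickened surface `S × [0,1]`. -/
abbrev thickModel : ModelWithCorners ℝ (Plane × EuclideanSpace ℝ (Fin 1))
    (ModelProd H (EuclideanHalfSpace 1)) :=
  I.prod (𝓡∂ 1)

/-- `f` is a smooth embedding of the disjoint union of `k` circles into `S × [0,1]`: a smooth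
injective immersion (the source is compact). -/
structure IsLinkEmbedding {k : ℕ} (f : Fin k → Circle → S × unitInterval) : Prop where
  smooth : ∀ i, ContMDiff (𝓡 1) (thickModel I) ∞ (f i)
  immersion : ∀ i z, Function.Injective (mfderiv (𝓡 1) (thickModel I) (f i) z)
  injective : Function.Injective (fun p : Fin k × Circle => f p.1 p.2)

/-- Smooth embeddings of `k` disjoint oriented circles into `S × [0,1]`. -/
structure LinkEmbedding (k : ℕ) where
  map : Fin k → Circle → S × unitInterval
  isEmbedding : IsLinkEmbedding I S map

/-- Two embeddings are isotopic, up to a renumbering `e` of the components: there is a smooth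
one-parameter family of embeddings, indexed by `[0,1]`, that joins them. -/
def Isotopic (f g : Σ k : ℕ, LinkEmbedding I S k) : Prop :=
  ∃ e : Fin f.1 ≃ Fin g.1, ∃ F : Fin f.1 → unitInterval × Circle → S × unitInterval,
    (∀ i, ContMDiff ((𝓡∂ 1).prod (𝓡 1)) (thickModel I) ∞ (F i)) ∧
    (∀ t : unitInterval, IsLinkEmbedding I S (fun i z => F i (t, z))) ∧
    (∀ i z, F i (0, z) = f.2.map i z) ∧
    (∀ i z, F i (1, z) = g.2.map (e i) z)

/-- Links in `S × [0,1]`: isotopy classes of smooth embeddings of finitely many oriented circles,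
whose components are not numbered. The empty link (`k = 0`) is included. -/
def Link : Type _ := Quot (Isotopic I S)

/-- The link represented by an embedding. -/
def LinkEmbedding.link {k : ℕ} (f : LinkEmbedding I S k) : Link I S := Quot.mk _ ⟨k, f⟩

/-- `ν` is a framed embedding of `k` circles: a smooth family of tangent vectors of `S × [0,1]`
along an embedding (the family of its base points), which is nowhere tangent to that embedding. -/
structure IsFramedEmbedding {k : ℕ}
    (ν : Fin k → Circle → TangentBundle (thickModel I) (S × unitInterval)) : Prop where
  smooth : ∀ i, ContMDiff (𝓡 1) (thickModel I).tangent ∞ (ν i)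
  isEmbedding : IsLinkEmbedding I S (fun i z => (ν i z).proj)
  transverse : ∀ i z, (ν i z).snd ∉
    Set.range (mfderiv (𝓡 1) (thickModel I) (fun w => (ν i w).proj) z)

/-- Framed embeddings of `k` disjoint oriented circles into `S × [0,1]`. -/
structure FramedEmbedding (k : ℕ) where
  frame : Fin k → Circle → TangentBundle (thickModel I) (S × unitInterval)
  isFramed : IsFramedEmbedding I S frame

/-- Isotopy of framed embeddings, up to a renumbering of the components. -/
def FramedIsotopic (f g : Σ k : ℕ, FramedEmbedding I S k) : Prop :=
  ∃ e : Fin f.1 ≃ Fin g.1, ∃ F : Fin f.1 → unitInterval × Circle → TangentBundle (thickModel I) (S × unitInterval),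
    (∀ i, ContMDiff ((𝓡∂ 1).prod (𝓡 1)) (thickModel I).tangent ∞ (F i)) ∧
    (∀ t : unitInterval, IsFramedEmbedding I S (fun i z => F i (t, z))) ∧
    (∀ i z, F i (0, z) = f.2.frame i z) ∧
    (∀ i z, F i (1, z) = g.2.frame (e i) z)

/-- Framed links in `S × [0,1]`. -/
def FramedLink : Type _ := Quot (FramedIsotopic I S)

/-- The framed link represented by a framed embedding. -/
def FramedEmbedding.link {k : ℕ} (f : FramedEmbedding I S k) : FramedLink I S := Quot.mk _ ⟨k, f⟩

/-- The embedding that underlies a framed embedding. -/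
def FramedEmbedding.core {k : ℕ} (f : FramedEmbedding I S k) : LinkEmbedding I S k where
  map := fun i z => (f.frame i z).proj
  isEmbedding := f.isFramed.isEmbedding

/-! ### Link diagrams -/

/-- The velocity at `z` of the closed curve `γ` for the counterclockwise parametrisation
`s ↦ z * exp (i s)` of the circle. -/
def velocity (γ : Circle → S) (z : Circle) : TangentSpace I (γ z) :=
  (mfderiv 𝓘(ℝ, ℝ) I (fun s : ℝ => γ (z * Circle.exp s)) 0 (1 : ℝ) : Plane)

/-- A regular projection: an immersion of `k` circles into `S` whose only multiple points are
transverse double points. By compactness there are finitely many of these. -/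
structure RegularProjection (k : ℕ) where
  curve : Fin k × Circle → S
  smooth : ∀ i, ContMDiff (𝓡 1) I ∞ (fun z => curve (i, z))
  immersion : ∀ i z, velocity I S (fun w => curve (i, w)) z ≠ 0
  transverse : ∀ p q, p ≠ q → curve p = curve q →
    LinearIndependent ℝ ![(velocity I S (fun w => curve (p.1, w)) p.2 : Plane),
      (velocity I S (fun w => curve (q.1, w)) q.2 : Plane)]
  noTriple : ∀ p q r, curve p = curve q → curve q = curve r → p = q ∨ q = r ∨ p = r

/-- The vertices of a regular projection are its double points. -/
def RegularProjection.Vertex {k : ℕ} (P : RegularProjection I S k) : Type _ :=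
  {v : S // ∃ p q, p ≠ q ∧ P.curve p = v ∧ P.curve q = v}

/-- A link diagram: a regular projection with an oriented crossing number `±1` at each vertex. -/
structure LinkDiagram (k : ℕ) extends RegularProjection I S k where
  sign : toRegularProjection.Vertex → ℤˣ

open Classical in
/-- The diagram obtained from `D` by giving the vertices in `A` the crossing numbers `ε` and
keeping all other crossing numbers. -/
def LinkDiagram.reassign {k : ℕ} (D : LinkDiagram I S k)
    (A : Finset D.toRegularProjection.Vertex) (ε : A → ℤˣ) : LinkDiagram I S k where
  toRegularProjection := D.toRegularProjection
  sign := fun v => if h : v ∈ A then ε ⟨v, h⟩ else D.sign v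

variable {I S}

open Classical in
/-- The sign of a crossing at `v` whose upper strand has velocity `a` and whose lower strand has
velocity `b`: it is `+1` iff `(a, b)` is a positively oriented basis of the tangent plane. -/
def SurfaceOrientation.crossingSign (o : SurfaceOrientation I S) (v : S)
    (a b : TangentSpace I v) : ℤˣ :=
  if ∃ e : Module.Basis (Fin 2) ℝ (TangentSpace I v), e 0 = a ∧ e 1 = b ∧
      e.orientation = o.orient v then 1 else -1

/-- `D` is a diagram of the embedding `f`: the projection of `f` to `S` is the curve of `D`, and
at each vertex the sign of the crossing of `f` is the crossing number of `D`. Any diagram has such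
an embedding, and any two of them are isotopic by linear interpolation of the heights. -/
def LinkEmbedding.HasDiagram (o : SurfaceOrientation I S) {k : ℕ} (f : LinkEmbedding I S k)
    (D : LinkDiagram I S k) : Prop :=
  (∀ p, (f.map p.1 p.2).1 = D.curve p) ∧
  ∀ (p q : Fin k × Circle) (hne : p ≠ q) (hpq : D.curve q = D.curve p),
    (f.map q.1 q.2).2 < (f.map p.1 p.2).2 →
    D.sign ⟨D.curve p, p, q, hne, rfl, hpq⟩ =
      o.crossingSign (D.curve p) (velocity I S (fun w => D.curve (p.1, w)) p.2)
        (velocity I S (fun w => D.curve (q.1, w)) q.2 : Plane)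

/-- `D` is a diagram of the framed embedding `f`: it is a diagram of the underlying embedding,
and the framing is vertical. (In the normal bundle the vertical framing is the blackboard framing
turned by a right angle, so that the two define the same framed link.) -/
def FramedEmbedding.HasDiagram (o : SurfaceOrientation I S) {k : ℕ} (f : FramedEmbedding I S k)
    (D : LinkDiagram I S k) : Prop :=
  (f.core I S).HasDiagram o D ∧
  ∀ i z, mfderiv (thickModel I) I (Prod.fst : S × unitInterval → S) (f.frame i z).proj (f.frame i z).snd = 0

/-- The link `[D]` of a diagram `D`, as a relation between diagrams and links. -/
def IsLinkOf (o : SurfaceOrientation I S) {k : ℕ} (D : LinkDiagram I S k) (L : Link I S) : Prop :=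
  ∃ f : LinkEmbedding I S k, f.HasDiagram o D ∧ f.link I S = L

/-- The framed link `[D]` of a diagram `D`, as a relation between diagrams and framed links. -/
def IsFramedLinkOf (o : SurfaceOrientation I S) {k : ℕ} (D : LinkDiagram I S k)
    (L : FramedLink I S) : Prop :=
  ∃ f : FramedEmbedding I S k, f.HasDiagram o D ∧ f.link I S = L

/-! ### The filtration and finite type invariants

Both are written once for a type `Q` of link types (`Link I S` or `FramedLink I S`) with the
relation `rep D L` saying that `L` is the link type `[D]` of the diagram `D`. -/

open Classical in
/-- `x` is the alternating sum `∇_A D = ∑_ε (∏_{v ∈ A} ε_v) [D^ε]`, where `ε` runs over all the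
assignments of crossing numbers to the vertices in `A`. -/
def IsNabla (K : Type*) [Field K] {Q : Type*} (rep : ∀ {k : ℕ}, LinkDiagram I S k → Q → Prop)
    {k : ℕ} (D : LinkDiagram I S k) (A : Finset D.toRegularProjection.Vertex) (x : Q →₀ K) : Prop :=
  ∃ L : (A → ℤˣ) → Q, (∀ ε, rep (D.reassign I S A ε) (L ε)) ∧
    x = ∑ ε : A → ℤˣ, Finsupp.single (L ε) (∏ v : A, (((ε v : ℤˣ) : ℤ) : K))

/-- The `m`-th level of the filtration: the span of all `∇_A D` with `A` a set of `m` vertices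
of a link diagram `D`. -/
def filtration (K : Type*) [Field K] {Q : Type*}
    (rep : ∀ {k : ℕ}, LinkDiagram I S k → Q → Prop) (m : ℕ) : Submodule K (Q →₀ K) :=
  Submodule.span K {x | ∃ (k : ℕ) (D : LinkDiagram I S k)
    (A : Finset D.toRegularProjection.Vertex), A.card = m ∧ IsNabla K rep D A x}

/-- The intersection of all the levels of the filtration. -/
def filtrationInf (K : Type*) [Field K] {Q : Type*}
    (rep : ∀ {k : ℕ}, LinkDiagram I S k → Q → Prop) : Submodule K (Q →₀ K) :=
  ⨅ m : ℕ, filtration K rep m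

/-- A `K`-valued invariant is of finite type if its linear extension vanishes on some level of
the filtration. -/
def IsFiniteType {K : Type*} [Field K] {Q : Type*}
    (rep : ∀ {k : ℕ}, LinkDiagram I S k → Q → Prop) (v : Q → K) : Prop :=
  ∃ n : ℕ, ∀ x ∈ filtration K rep n, Finsupp.linearCombination K v x = 0

end SurfaceLinks

end

/-! A finite type invariant is a functional on L(Σ) that kills some L_n. If L_∞ = 0, then [L₁] -
[L₂] lies outside some L_n, and a functional that kills L_n but not this difference is the invariant
sought. The converse rests on the fact that finite type invariants form an algebra under the
pointwise product (`VanishesAt.mul`). An alternating sum over vertices is an iterated difference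
operator, and the discrete Leibniz rule bounds the order of a product (`altSum_mul_eq_zero`).
Separation of pairs therefore gives separation of finite sets, by the products of Lagrange
interpolation. Given x ≠ 0 in L_∞ and q in its support, some finite type w vanishes on the rest of
the support but not at q, so w(x) ≠ 0, a contradiction. Only the shape of the filtration matters, so
one argument with an arbitrary `rep` covers links and framed links. -/

namespace SurfaceLinks

/-! ### Alternating sums over sign assignments -/

noncomputable section AltSum

open Classical

variable {V R : Type*} [CommRing R]

/-- The sign assignment that agrees with `ε` on `A` and with `η` elsewhere. -/
def override (η : V → ℤˣ) (A : Finset V) (ε : A → ℤˣ) : V → ℤˣ :=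
  fun v => if h : v ∈ A then ε ⟨v, h⟩ else η v

/-- The alternating sum of `F` over all the ways to change the signs `η` on `A`. -/
def altSum (A : Finset V) (F : (V → ℤˣ) → R) (η : V → ℤˣ) : R :=
  ∑ ε : A → ℤˣ, (∏ v : A, (((ε v : ℤˣ) : ℤ) : R)) * F (override η A ε)

/-- The difference operator in the direction `v`. -/
def signDiff (v : V) (F : (V → ℤˣ) → R) (η : V → ℤˣ) : R :=
  F (Function.update η v 1) - F (Function.update η v (-1))

theorem override_insert (η : V → ℤˣ) {A : Finset V} {v : V} (hv : v ∉ A)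
    (ε : ↥(insert v A : Finset V) → ℤˣ) :
    override η (insert v A) ε =
      Function.update (override η A fun x => ε ⟨x, Finset.mem_insert_of_mem x.2⟩) v
        (ε ⟨v, Finset.mem_insert_self v A⟩) := by
  funext x
  by_cases hx : x = v
  · subst hx
    simp [override]
  · by_cases hA : x ∈ A <;> simp [override, hx, hA]

theorem override_update (η : V → ℤˣ) {A : Finset V} {v : V} (hv : v ∉ A) (s : ℤˣ)
    (ε : A → ℤˣ) :
    override (Function.update η v s) A ε = Function.update (override η A ε) v s := by
  funext x
  by_cases hx : x = v
  · subst hx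
    simp [override, hv]
  · by_cases hA : x ∈ A <;> simp [override, hx, hA]

theorem altSum_empty (F : (V → ℤˣ) → R) (η : V → ℤˣ) : altSum ∅ F η = F η := by
  have h : ∀ ε : (∅ : Finset V) → ℤˣ, override η ∅ ε = η := fun ε => by
    funext x
    simp [override]
  simp [altSum, h]

/-- Splitting off the value at `v` of a function on `insert v A`. -/
def insertSplit {A : Finset V} {v : V} (hv : v ∉ A) :
    (↥(insert v A : Finset V) → ℤˣ) ≃ ℤˣ × (A → ℤˣ) where
  toFun ε := (ε ⟨v, Finset.mem_insert_self v A⟩,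
    fun x => ε ⟨x, Finset.mem_insert_of_mem x.2⟩)
  invFun p x := if h : (x : V) = v then p.1
    else p.2 ⟨x, Finset.mem_of_mem_insert_of_ne x.2 h⟩
  left_inv ε := by
    funext ⟨x, hx⟩
    by_cases h : x = v
    · subst h
      simp
    · simp [h]
  right_inv p := by
    refine Prod.ext (by simp) ?_
    funext ⟨x, hx⟩
    have h : x ≠ v := fun h => hv (h ▸ hx)
    simp [h]

/-- Summing over the sign at `v` first exhibits `altSum A` as a composite of the operators
`signDiff`, which makes induction on `A` possible. -/
theorem altSum_insert {A : Finset V} {v : V} (hv : v ∉ A) (F : (V → ℤˣ) → R) (η : V → ℤˣ) :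
    altSum (insert v A) F η = altSum A (signDiff v F) η := by
  have key : altSum (insert v A) F η = ∑ p : ℤˣ × (A → ℤˣ),
      ((p.1 : ℤ) : R) * (∏ x : A, ((p.2 x : ℤ) : R)) *
        F (Function.update (override η A p.2) v p.1) := by
    refine Fintype.sum_equiv (insertSplit hv) _ _ fun ε => ?_
    rw [override_insert η hv]
    congr 1
    rw [Finset.univ_eq_attach, Finset.attach_insert, Finset.prod_insert, Finset.prod_image]
    · rfl
    · intro x _ y _ h
      exact Subtype.ext (Subtype.mk.inj h)
    · intro h
      obtain ⟨y, _, hy⟩ := Finset.mem_image.1 h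
      have hyv : (y : V) = v := congrArg Subtype.val hy
      exact hv (hyv ▸ y.2)
  rw [key, Fintype.sum_prod_type, UnitsInt.univ, Finset.sum_pair (by decide),
    ← Finset.sum_add_distrib]
  refine Finset.sum_congr rfl fun ε _ => ?_
  simp only [signDiff, Units.val_one, Units.val_neg, Int.cast_one, Int.cast_neg]
  ring

theorem altSum_comp_update {A : Finset V} {v : V} (hv : v ∉ A) (s : ℤˣ) (F : (V → ℤˣ) → R)
    (η : V → ℤˣ) :
    altSum A (fun σ => F (Function.update σ v s)) η = altSum A F (Function.update η v s) := by
  simp only [altSum, override_update η hv]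

theorem altSum_add (A : Finset V) (F G : (V → ℤˣ) → R) (η : V → ℤˣ) :
    altSum A (fun σ => F σ + G σ) η = altSum A F η + altSum A G η := by
  simp only [altSum, mul_add, Finset.sum_add_distrib]

theorem altSum_const {A : Finset V} (hA : A.Nonempty) (c : R) (η : V → ℤˣ) :
    altSum A (fun _ => c) η = 0 := by
  obtain ⟨v, hv⟩ := hA
  rw [← Finset.insert_erase hv, altSum_insert (Finset.notMem_erase v A)]
  simp [altSum, signDiff]

/-- Discrete Leibniz rule: insert the mixed term F(-1)·G(+1). Hence the two undifferentiated factors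
are frozen at opposite signs. -/
theorem signDiff_mul (v : V) (F G : (V → ℤˣ) → R) :
    signDiff v (fun σ => F σ * G σ) = fun σ =>
      signDiff v F σ * G (Function.update σ v 1) +
        F (Function.update σ v (-1)) * signDiff v G σ := by
  funext σ
  simp only [signDiff]
  ring

/-- If all the alternating sums of `F` of order `a` and all those of `G` of order `b` vanish, then
so do those of the product of order `a + b - 1` or more. -/
theorem altSum_mul_eq_zero (A : Finset V) : ∀ (a b : ℕ) (F G : (V → ℤˣ) → R),
    a + b ≤ A.card + 1 →
    (∀ B ⊆ A, B.card = a → ∀ η, altSum B F η = 0) →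
    (∀ B ⊆ A, B.card = b → ∀ η, altSum B G η = 0) →
    ∀ η, altSum A (fun σ => F σ * G σ) η = 0 := by
  have zero_left : ∀ (A : Finset V) (F : (V → ℤˣ) → R),
      (∀ B ⊆ A, B.card = 0 → ∀ η, altSum B F η = 0) → ∀ η, F η = 0 := fun A F h η => by
    simpa [altSum_empty] using h ∅ (Finset.empty_subset A) rfl η
  induction A using Finset.induction_on with
  | empty =>
    intro a b F G hab hF hG η
    rw [altSum_empty]
    rcases Nat.eq_zero_or_pos a with rfl | ha
    · rw [zero_left ∅ F hF, zero_mul]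
    -- Here `a + b ≤ 1`, so one of the orders is 0 and the corresponding factor vanishes
    -- identically.
    · obtain rfl : b = 0 := by simp at hab; omega
      rw [zero_left ∅ G hG, mul_zero]
  | insert v A hv ih =>
    intro a b F G hab hF hG η
    have card_insert : ∀ B ⊆ A, (insert v B).card = B.card + 1 := fun B hB =>
      Finset.card_insert_of_notMem fun h => hv (hB h)
    -- Freezing the sign at `v` preserves the order of vanishing on subsets of `A`; applying
    -- `signDiff v` lowers it by one.
    have shift : ∀ (c : ℕ) (E : (V → ℤˣ) → R) (s : ℤˣ),
        (∀ B ⊆ insert v A, B.card = c → ∀ η, altSum B E η = 0) →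
        ∀ B ⊆ A, B.card = c → ∀ η, altSum B (fun σ => E (Function.update σ v s)) η = 0 :=
      fun c E s hE B hB hc η => by
        rw [altSum_comp_update (fun h => hv (hB h))]
        exact hE B (hB.trans (Finset.subset_insert v A)) hc _
    have diff : ∀ (c : ℕ) (E : (V → ℤˣ) → R),
        (∀ B ⊆ insert v A, B.card = c + 1 → ∀ η, altSum B E η = 0) →
        ∀ B ⊆ A, B.card = c → ∀ η, altSum B (signDiff v E) η = 0 :=
      fun c E hE B hB hc η => by
        rw [← altSum_insert (fun h => hv (hB h))]
        exact hE _ (Finset.insert_subset_insert v hB) (by rw [card_insert B hB, hc]) η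
    rw [card_insert A subset_rfl] at hab
    rcases a with _ | a
    · simp [altSum, zero_left _ F hF]
    rcases b with _ | b
    · simp [altSum, zero_left _ G hG]
    -- In each Leibniz term one order drops by one, and so does the cardinality, which preserves the
    -- bound.
    rw [altSum_insert hv, signDiff_mul, altSum_add,
      ih a (b + 1) (signDiff v F) (fun σ => G (Function.update σ v 1)) (by omega)
        (diff a F hF) (shift _ G 1 hG),
      ih (a + 1) b (fun σ => F (Function.update σ v (-1))) (signDiff v G) (by omega)
        (shift _ F (-1) hF) (diff b G hG), add_zero]

end AltSum

/-! ### The algebra of finite type invariants -/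

section FiniteType

variable {H : Type*} [TopologicalSpace H] {I : ModelWithCorners ℝ Plane H}
variable {S : Type*} [TopologicalSpace S] [ChartedSpace H S]
variable {K : Type*} [Field K] {Q : Type*} (rep : ∀ {k : ℕ}, LinkDiagram I S k → Q → Prop)

/-- The linear extension of `v` vanishes on the `n`-th level of the filtration. -/
def VanishesAt (n : ℕ) (v : Q → K) : Prop :=
  ∀ x ∈ filtration K rep n, Finsupp.linearCombination K v x = 0

theorem reassign_eq {k : ℕ} (D : LinkDiagram I S k) (A : Finset D.toRegularProjection.Vertex)
    (ε : A → ℤˣ) :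
    D.reassign I S A ε = ⟨D.toRegularProjection, override D.sign A ε⟩ := rfl

theorem override_restrict_override {V : Type*} {A B : Finset V} (hB : B ⊆ A) (s η : V → ℤˣ)
    (ε : B → ℤˣ) :
    override s A (fun x => override η B ε x) = override (override s A fun x => η x) B ε := by
  funext x
  by_cases hxA : x ∈ A
  · by_cases hxB : x ∈ B <;> simp [override, hxA, hxB]
  · have hxB : x ∉ B := fun h => hxA (hB h)
    simp [override, hxA, hxB]

open Classical in
theorem vanishesAt_iff {n : ℕ} {v : Q → K} :
    VanishesAt rep n v ↔ ∀ (k : ℕ) (D : LinkDiagram I S k)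
      (A : Finset D.toRegularProjection.Vertex) (L : (A → ℤˣ) → Q), A.card = n →
      (∀ ε, rep (D.reassign I S A ε) (L ε)) →
      ∑ ε : A → ℤˣ, (∏ x : A, (((ε x : ℤˣ) : ℤ) : K)) * v (L ε) = 0 := by
  constructor
  · intro h k D A L hA hL
    have := h _ (Submodule.subset_span ⟨k, D, A, hA, L, hL, rfl⟩)
    simpa [map_sum, Finsupp.linearCombination_single] using this
  · intro h x hx
    have : filtration K rep n ≤ LinearMap.ker (Finsupp.linearCombination K v) := by
      refine Submodule.span_le.2 ?_
      rintro _ ⟨k, D, A, hA, L, hL, rfl⟩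
      simpa [map_sum, Finsupp.linearCombination_single] using h k D A L hA hL
    exact this hx

/-- As `rep` is only a relation, one choice `L` over `A` must serve every `B ⊆ A`. Moving the base
diagram to the signs `η` on `A` makes its resolutions on `B` resolutions of `D` on `A`. -/
theorem VanishesAt.altSum_eq_zero {n : ℕ} {v : Q → K} (hv : VanishesAt rep n v) {k : ℕ}
    {D : LinkDiagram I S k} {A : Finset D.toRegularProjection.Vertex} {L : (A → ℤˣ) → Q}
    (hL : ∀ ε, rep (D.reassign I S A ε) (L ε)) {B : Finset D.toRegularProjection.Vertex}
    (hB : B ⊆ A) (hn : B.card = n) (η : D.toRegularProjection.Vertex → ℤˣ) :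
    altSum B (fun σ => v (L fun x => σ x)) η = 0 := by
  refine (vanishesAt_iff rep).1 hv k
    ⟨D.toRegularProjection, override D.sign A fun x => η x⟩ B
    (fun ε => L fun x => override η B ε x) hn fun ε => ?_
  have := hL fun x => override η B ε x
  rw [reassign_eq, override_restrict_override hB] at this
  exact this

theorem sum_eq_altSum {V : Type*} [DecidableEq V] (A : Finset V) (f : (A → ℤˣ) → K)
    (η : V → ℤˣ) :
    ∑ ε : A → ℤˣ, (∏ x : A, (((ε x : ℤˣ) : ℤ) : K)) * f ε =
      altSum A (fun σ => f fun x => σ x) η := by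
  unfold altSum
  have h : ∀ ε : A → ℤˣ, (fun x : A => override η A ε x) = ε := fun ε => by
    funext x
    simp [override]
  simp only [h]
  congr!

theorem VanishesAt.mul {n m : ℕ} {v w : Q → K} (hv : VanishesAt rep n v)
    (hw : VanishesAt rep m w) : VanishesAt rep (n + m) (fun q => v q * w q) := by
  classical
  refine (vanishesAt_iff rep).2 fun k D A L hA hL => ?_
  have := altSum_mul_eq_zero A n m (fun σ => v (L fun x => σ x)) (fun σ => w (L fun x => σ x))
    (by omega) (fun B hB hn η => hv.altSum_eq_zero rep hL hB hn η)
    (fun B hB hn η => hw.altSum_eq_zero rep hL hB hn η) D.sign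
  rw [← sum_eq_altSum A (fun ε => v (L ε) * w (L ε)) D.sign] at this
  convert this

theorem vanishesAt_const {n : ℕ} (hn : n ≠ 0) (c : K) :
    VanishesAt rep n (fun _ => c) := by
  classical
  refine (vanishesAt_iff rep).2 fun k D A L hA hL => ?_
  have hne : A.Nonempty := Finset.card_ne_zero.1 (hA ▸ hn)
  have := altSum_const hne c D.sign
  rw [← sum_eq_altSum A (fun _ => c) D.sign] at this
  convert this

theorem isFiniteType_const (c : K) : IsFiniteType rep (fun _ => c) :=
  ⟨1, vanishesAt_const rep one_ne_zero c⟩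

variable {rep}

theorem IsFiniteType.mul {v w : Q → K} (hv : IsFiniteType rep v) (hw : IsFiniteType rep w) :
    IsFiniteType rep (fun q => v q * w q) := by
  obtain ⟨n, hn⟩ := hv
  obtain ⟨m, hm⟩ := hw
  exact ⟨n + m, VanishesAt.mul rep hn hm⟩

theorem IsFiniteType.sub_const {v : Q → K} (hv : IsFiniteType rep v) (c : K) :
    IsFiniteType rep (fun q => v q - c) := by
  obtain ⟨n, hn⟩ := hv
  refine ⟨n + 1, fun x hx => ?_⟩
  -- Multiplying by the constant 1 moves `v` up to level `n + 1`, where every constant vanishes too;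
  -- level 0 would not do for constants.
  have h₁ := VanishesAt.mul rep hn (vanishesAt_const rep one_ne_zero (1 : K)) x hx
  have h₂ := vanishesAt_const rep n.succ_ne_zero c x hx
  simp only [mul_one] at h₁
  rw [Finsupp.linearCombination_apply] at h₁ h₂ ⊢
  simp only [smul_sub, Finsupp.sum_sub, h₁, h₂, sub_zero]

theorem IsFiniteType.prod {ι : Type*} (s : Finset ι) (v : ι → Q → K)
    (hv : ∀ i, IsFiniteType rep (v i)) : IsFiniteType rep (fun q => ∏ i ∈ s, v i q) := by
  classical
  induction s using Finset.induction_on with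
  | empty => simpa using isFiniteType_const rep (1 : K)
  | insert i s hi ih => simpa [Finset.prod_insert hi] using (hv i).mul ih

/-! ### Separation of links and the intersection of the filtration -/

/-- Finite type invariants separate the points of a finite set as soon as they separate any two
points. -/
theorem exists_isFiniteType_ne_zero
    (h : ∀ L₁ L₂ : Q, L₁ ≠ L₂ → ∃ v : Q → K, IsFiniteType rep v ∧ v L₁ ≠ v L₂)
    (s : Finset Q) (q : Q) (hq : q ∉ s) :
    ∃ w : Q → K, IsFiniteType rep w ∧ w q ≠ 0 ∧ ∀ p ∈ s, w p = 0 := by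
  choose! v hv using fun p : Q => fun hp : q ≠ p => h q p hp
  have hne : ∀ p : s, q ≠ p := fun p hp => hq (hp ▸ p.2)
  -- Numerator of the Lagrange interpolation polynomial, with a separate invariant `v p` for each
  -- node `p`.
  refine ⟨fun x => ∏ p : s, (v p x - v p p), ?_, ?_, fun p hp => ?_⟩
  · exact IsFiniteType.prod _ (fun p : s => fun x => v p x - v p p) fun p =>
      (hv p (hne p)).1.sub_const _
  · exact Finset.prod_ne_zero_iff.2 fun p _ => sub_ne_zero.2 (hv p (hne p)).2
  · exact Finset.prod_eq_zero (Finset.mem_univ ⟨p, hp⟩) (sub_self _)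

theorem separates_iff_filtrationInf_eq_bot :
    (∀ L₁ L₂ : Q, L₁ ≠ L₂ → ∃ v : Q → K, IsFiniteType rep v ∧ v L₁ ≠ v L₂) ↔
      filtrationInf K rep = ⊥ := by
  classical
  constructor
  · intro h
    refine (Submodule.eq_bot_iff _).2 fun x hx => ?_
    by_contra hx0
    obtain ⟨q, hq⟩ := Finsupp.support_nonempty_iff.2 hx0
    obtain ⟨w, ⟨n, hn⟩, hwq, hw⟩ :=
      exists_isFiniteType_ne_zero h (x.support.erase q) q (Finset.notMem_erase q _)
    have hzero := hn x ((Submodule.mem_iInf _).1 hx n)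
    -- Only the term at `q` survives, so `x q * w q = 0`.
    rw [Finsupp.linearCombination_apply, Finsupp.sum, Finset.sum_eq_single_of_mem q hq
      fun p hp hpq => by rw [hw p (Finset.mem_erase.2 ⟨hpq, hp⟩), smul_zero]] at hzero
    exact (mul_ne_zero (Finsupp.mem_support_iff.1 hq) hwq) hzero
  · intro h L₁ L₂ hL
    have hx : (Finsupp.single L₁ 1 - Finsupp.single L₂ 1 : Q →₀ K) ∉ filtrationInf K rep := by
      rw [h, Submodule.mem_bot, sub_eq_zero]
      exact fun he => hL (Finsupp.single_left_injective one_ne_zero he)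
    obtain ⟨n, hn⟩ := not_forall.1 (mt (Submodule.mem_iInf _).2 hx)
    obtain ⟨φ, hφ, hle⟩ := Submodule.exists_le_ker_of_notMem hn
    have hlin : Finsupp.linearCombination K (fun q => φ (Finsupp.single q 1)) = φ := by
      ext q
      simp
    refine ⟨fun q => φ (Finsupp.single q 1), ⟨n, fun x hx => ?_⟩, fun he => hφ ?_⟩
    · rw [hlin]
      exact hle hx
    · rw [map_sub, sub_eq_zero]
      exact he

end FiniteType

end SurfaceLinks

open SurfaceLinks in
theorem mainTheorem11 {H : Type*} [TopologicalSpace H] (I : ModelWithCorners ℝ Plane H)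
    (S : Type*) [TopologicalSpace S] [T2Space S] [SecondCountableTopology S]
    [ChartedSpace H S] [IsManifold I ∞ S] (o : SurfaceOrientation I S)
    (K : Type*) [Field K] :
    ((∀ L₁ L₂ : Link I S, L₁ ≠ L₂ →
        ∃ v : Link I S → K, IsFiniteType (IsLinkOf o) v ∧ v L₁ ≠ v L₂) ↔
      filtrationInf K (IsLinkOf o) = ⊥) ∧
    ((∀ L₁ L₂ : FramedLink I S, L₁ ≠ L₂ →
        ∃ v : FramedLink I S → K, IsFiniteType (IsFramedLinkOf o) v ∧ v L₁ ≠ v L₂) ↔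
      filtrationInf K (IsFramedLinkOf o) = ⊥) :=
  ⟨separates_iff_filtrationInf_eq_bot, separates_iff_filtrationInf_eq_bot⟩
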